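/- Let $K$ be an arbitrary field and let $R=K[x,y,z]$ with the standard grading. For a homogeneous ideal $I\subset R$ such that $A=R/I$ is Artinian, $A$ is called level if its socle $\{a\in A : xa=ya=za=0\}$ is concentrated in one degree, and its socle degree is the largest $e$ with $A_e\neq 0$. The algebra $A$ has the weak Lefschetz property (WLP) if there is a linear form $\ell\in A_1$ such that for every $d\ge 0$ the multiplication map $\times\ell\colon A_d\to A_{d+1}$ is injective or surjective. The ideal $I$ is an almost complete intersection if its minimal number of generators is one more than its height. For every even integer $e\ge 0$ with $e\notin\{0,2,6,10\}$ there is a monomial almost complete intersection $I\subset R$ such that $R/I$ is Artinian, level, of socle degree $e$, and fails the WLP. Moreover, $I$ can be chosen of the form $$I=(x^k,\;y^k,\;z^k,\;x^\alpha y^\alpha z^\alpha),\qquad \alpha\in\{1,3\},\quad k\ge 2\alpha+1 \text{ odd}.$$ -/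

import Mathlib

open MvPolynomial

namespace MonomialACI

variable {σ K : Type*} [Field K]

/-- An ideal of a polynomial ring is monomial if it is generated by monomials. -/
def IsMonomialIdeal (I : Ideal (MvPolynomial σ K)) : Prop :=
  ∃ S : Set (σ →₀ ℕ), I = Ideal.span ((fun s => monomial s (1 : K)) '' S)

/-- An almost complete intersection: an ideal whose minimal number of generators is
one more than its height (codimension). -/
def IsAlmostCompleteIntersection {R : Type*} [CommRing R] (I : Ideal R) : Prop :=
  I.FG ∧ (Submodule.spanFinrank I : ℕ∞) = I.height + 1

/-- The degree `d` component of the quotient `K[x_i : i ∈ σ] / I`, for a homogeneous ideal `I`: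
the classes of the forms of degree `d`. -/
noncomputable def gradedPiece (I : Ideal (MvPolynomial σ K)) (d : ℕ) :
    Submodule K (MvPolynomial σ K ⧸ I) :=
  (homogeneousSubmodule σ K d).map (Ideal.Quotient.mkₐ K I).toLinearMap

/-- `ℓ` is a Lefschetz element of `A = K[x_i : i ∈ σ] / I`: it is a linear form of `A`, and each
multiplication map `ℓ : A_d → A_{d+1}` has maximal rank, i.e. is injective or surjective. -/
def IsLefschetzElement (I : Ideal (MvPolynomial σ K)) (ℓ : MvPolynomial σ K ⧸ I) : Prop :=
  ℓ ∈ gradedPiece I 1 ∧ ∀ d : ℕ,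
    Set.InjOn (fun a => ℓ * a) (gradedPiece I d : Set (MvPolynomial σ K ⧸ I)) ∨
    Set.SurjOn (fun a => ℓ * a) (gradedPiece I d : Set (MvPolynomial σ K ⧸ I))
      (gradedPiece I (d + 1) : Set (MvPolynomial σ K ⧸ I))

/-- The weak Lefschetz property of the standard graded Artinian algebra `K[x_i : i ∈ σ] / I`. -/
def HasWLP (I : Ideal (MvPolynomial σ K)) : Prop :=
  ∃ ℓ : MvPolynomial σ K ⧸ I, IsLefschetzElement I ℓ

/-- The socle of `K[x_i : i ∈ σ] / I`: the elements annihilated by all variables, i.e. by the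
homogeneous maximal ideal. -/
def socle (I : Ideal (MvPolynomial σ K)) : Set (MvPolynomial σ K ⧸ I) :=
  {a | ∀ i : σ, Ideal.Quotient.mk I (X i) * a = 0}

/-- The (Artinian, graded) algebra `K[x_i : i ∈ σ] / I` is level: its socle is concentrated in
one degree. -/
def IsLevel (I : Ideal (MvPolynomial σ K)) : Prop :=
  ∃ d : ℕ, socle I ⊆ (gradedPiece I d : Set (MvPolynomial σ K ⧸ I))

/-- The socle degree of the (Artinian, graded) algebra `K[x_i : i ∈ σ] / I` is `e`: this is the
largest degree in which the algebra is not zero. -/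
def HasSocleDegree (I : Ideal (MvPolynomial σ K)) (e : ℕ) : Prop :=
  gradedPiece I e ≠ ⊥ ∧ ∀ d : ℕ, e < d → gradedPiece I d = ⊥

end MonomialACI

/-! Write k = 2m + 1. A standard monomial killed by every variable has exponents k - 1, k - 1, α - 1
in some order. So the quotient is level of socle degree 2k + α - 3, which is 4m for α = 1 and 4m + 2
for α = 3.

Every linear form fails to have maximal rank in the same place, from degree d = k + α - 2 to d + 1.
Since the ideal is monomial, rescaling the variables turns a form with three nonzero coefficients
into x + y + z, which is invariant under swapping x and y. Symmetric forms have one dimension per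
orbit of standard monomials, and the number of orbits drops from d to d + 1
(`card_orbitReps_one_lt`, `card_orbitReps_three_lt`), so there is a kernel. Alternating functionals
have one dimension per free orbit, and that number rises (`card_freeOrbitReps_one_lt`,
`card_freeOrbitReps_three_lt`), so some nonzero functional kills the image. Orbits are counted and
nothing is averaged, so the characteristic plays no role. Forms with a zero coefficient have an
explicit kernel element and functional (`HasKernel.of_two`, `HasCokernel.of_two`). -/

namespace MonomialACI

/-! ### Dimension count. -/

section LinearAlgebra

/-- A linear operator on functions has a nonzero kernel element supported on `S` after restriction
to a smaller finite set `T`. -/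
lemma exists_ne_zero_supported {K ι : Type*} [Field K] (S T : Finset ι) (hST : T.card < S.card)
    (E : (ι → K) →ₗ[K] (ι → K)) :
    ∃ h : ι → K, h ≠ 0 ∧ (∀ x, h x ≠ 0 → x ∈ S) ∧ ∀ t ∈ T, E h t = 0 := by
  let ext : (S → K) →ₗ[K] (ι → K) := Function.ExtendByZero.linearMap K (Subtype.val : S → ι)
  let res : (ι → K) →ₗ[K] (T → K) := LinearMap.funLeft K K (Subtype.val : T → ι)
  have hker : LinearMap.ker (res ∘ₗ E ∘ₗ ext) ≠ ⊥ :=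
    LinearMap.ker_ne_bot_of_finrank_lt (by simpa using hST)
  obtain ⟨f, hf, hf0⟩ := Submodule.exists_mem_ne_zero_of_ne_bot hker
  refine ⟨ext f, ?_, ?_, ?_⟩
  · intro h
    apply hf0
    ext s
    have := congrFun h s.1
    simpa [ext, Subtype.val_injective.extend_apply] using this
  · intro x hx
    by_contra hxS
    apply hx
    simp only [ext, Function.ExtendByZero.linearMap_apply]
    rw [Function.extend_apply']
    · rfl
    · rintro ⟨s, rfl⟩
      exact hxS s.2
  · intro t ht
    exact congrFun (LinearMap.mem_ker.mp hf) ⟨t, ht⟩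

end LinearAlgebra

/-! ### Kernels and cokernels in terms of exponents. -/

section Exponents

variable {K : Type*} [Field K]

/-- The monomial `x^i y^j z^l` does not lie in `(x^k, y^k, z^k, x^α y^α z^α)`. -/
def IsStandard (k α i j l : ℕ) : Prop :=
  i < k ∧ j < k ∧ l < k ∧ (i < α ∨ j < α ∨ l < α)

instance (k α i j l : ℕ) : Decidable (IsStandard k α i j l) :=
  inferInstanceAs (Decidable (_ ∧ _))

/-- The coefficient at `x^i y^j z^l` of the product of `a x + b y + c z` with the polynomial that
has coefficient function `g`. -/
def linearMulCoeff (a b c : K) (g : ℕ → ℕ → ℕ → K) (i j l : ℕ) : K :=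
  a * (if i = 0 then 0 else g (i - 1) j l) + b * (if j = 0 then 0 else g i (j - 1) l) +
    c * (if l = 0 then 0 else g i j (l - 1))

/-- Multiplication by `a x + b y + c z` from degree `d` to degree `d + 1` has a nonzero kernel,
in terms of coefficient functions. -/
def HasKernel (k α d : ℕ) (a b c : K) : Prop :=
  ∃ g : ℕ → ℕ → ℕ → K, (∀ i j l, g i j l ≠ 0 → IsStandard k α i j l ∧ i + j + l = d) ∧
    (∃ i j l, g i j l ≠ 0) ∧
    ∀ i j l, IsStandard k α i j l → i + j + l = d + 1 → linearMulCoeff a b c g i j l = 0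

/-- Multiplication by `a x + b y + c z` from degree `d` to degree `d + 1` has image annihilated by
a nonzero functional, in terms of the values of the functional on monomials. -/
def HasCokernel (k α d : ℕ) (a b c : K) : Prop :=
  ∃ g : ℕ → ℕ → ℕ → K, (∀ i j l, g i j l ≠ 0 → IsStandard k α i j l ∧ i + j + l = d + 1) ∧
    (∃ i j l, g i j l ≠ 0) ∧
    ∀ i j l, i + j + l = d → a * g (i + 1) j l + b * g i (j + 1) l + c * g i j (l + 1) = 0

lemma HasKernel.swap_left {k α d : ℕ} {a b c : K} (h : HasKernel k α d a b c) :
    HasKernel k α d b a c := by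
  obtain ⟨g, hg, ⟨i, j, l, hne⟩, h0⟩ := h
  refine ⟨fun i j l => g j i l, fun i j l h => ?_, ⟨j, i, l, hne⟩, fun i j l hs hd => ?_⟩
  · have := hg j i l h
    unfold IsStandard at *
    omega
  · rw [← h0 j i l (by unfold IsStandard at *; omega) (by omega)]
    simp only [linearMulCoeff]
    ring

lemma HasKernel.swap_right {k α d : ℕ} {a b c : K} (h : HasKernel k α d a b c) :
    HasKernel k α d a c b := by
  obtain ⟨g, hg, ⟨i, j, l, hne⟩, h0⟩ := h
  refine ⟨fun i j l => g i l j, fun i j l h => ?_, ⟨i, l, j, hne⟩, fun i j l hs hd => ?_⟩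
  · have := hg i l j h
    unfold IsStandard at *
    omega
  · rw [← h0 i l j (by unfold IsStandard at *; omega) (by omega)]
    simp only [linearMulCoeff]
    ring

lemma HasCokernel.swap_left {k α d : ℕ} {a b c : K} (h : HasCokernel k α d a b c) :
    HasCokernel k α d b a c := by
  obtain ⟨g, hg, ⟨i, j, l, hne⟩, h0⟩ := h
  refine ⟨fun i j l => g j i l, fun i j l h => ?_, ⟨j, i, l, hne⟩, fun i j l hd => ?_⟩
  · have := hg j i l h
    unfold IsStandard at *
    omega
  · rw [← h0 j i l (by omega)]
    ring

lemma HasCokernel.swap_right {k α d : ℕ} {a b c : K} (h : HasCokernel k α d a b c) :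
    HasCokernel k α d a c b := by
  obtain ⟨g, hg, ⟨i, j, l, hne⟩, h0⟩ := h
  refine ⟨fun i j l => g i l j, fun i j l h => ?_, ⟨i, l, j, hne⟩, fun i j l hd => ?_⟩
  · have := hg i l j h
    unfold IsStandard at *
    omega
  · rw [← h0 i l j (by omega)]
    ring

/-- Rescaling the variables reduces a linear form with nonzero coefficients to `x + y + z`. -/
lemma HasKernel.of_one {k α d : ℕ} {a b c : K} (ha : a ≠ 0) (hb : b ≠ 0) (hc : c ≠ 0)
    (h : HasKernel k α d (1 : K) 1 1) : HasKernel k α d a b c := by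
  obtain ⟨g, hg, ⟨i, j, l, hne⟩, h0⟩ := h
  refine ⟨fun i j l => a ^ i * b ^ j * c ^ l * g i j l, fun i j l h => ?_, ⟨i, j, l, ?_⟩,
    fun i j l hs hd => ?_⟩
  · exact hg i j l (right_ne_zero_of_mul h)
  · simp [ha, hb, hc, hne]
  · have := h0 i j l hs hd
    have e : linearMulCoeff a b c (fun i j l => a ^ i * b ^ j * c ^ l * g i j l) i j l =
        a ^ i * b ^ j * c ^ l * linearMulCoeff 1 1 1 g i j l := by
      simp only [linearMulCoeff]
      rcases i with _ | i <;> rcases j with _ | j <;> rcases l with _ | l <;> simp <;> ring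
    rw [e, this, mul_zero]

/-- Functionals are dual to forms, so the weights of the rescaling enter inverted. -/
lemma HasCokernel.of_one {k α d : ℕ} {a b c : K} (ha : a ≠ 0) (hb : b ≠ 0) (hc : c ≠ 0)
    (h : HasCokernel k α d (1 : K) 1 1) : HasCokernel k α d a b c := by
  obtain ⟨g, hg, ⟨i, j, l, hne⟩, h0⟩ := h
  refine ⟨fun i j l => (a ^ i * b ^ j * c ^ l)⁻¹ * g i j l, fun i j l h => ?_, ⟨i, j, l, ?_⟩,
    fun i j l hd => ?_⟩
  · exact hg i j l (right_ne_zero_of_mul h)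
  · simp [ha, hb, hc, hne]
  · have := h0 i j l hd
    have e : a * ((a ^ (i + 1) * b ^ j * c ^ l)⁻¹ * g (i + 1) j l) +
        b * ((a ^ i * b ^ (j + 1) * c ^ l)⁻¹ * g i (j + 1) l) +
        c * ((a ^ i * b ^ j * c ^ (l + 1))⁻¹ * g i j (l + 1)) =
        (a ^ i * b ^ j * c ^ l)⁻¹ *
          (1 * g (i + 1) j l + 1 * g i (j + 1) l + 1 * g i j (l + 1)) := by
      field_simp
      ring
    rw [e, this, mul_zero]

/-- A linear form in two variables has a kernel on the part of the quotient free of the third. -/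
lemma HasKernel.of_two {k α : ℕ} (hα : 1 ≤ α) (hk : α < k) (a b : K) (hab : a ≠ 0 ∨ b ≠ 0) :
    HasKernel k α (k + α - 2) a b 0 := by
  -- With N = k - α + 1, these are the coefficients of (xy)^(α-1) ((ax)^N - (-by)^N) / (ax + by).
  -- Its product with ax + by lies in (x^k, y^k). The bounds on i and j force α - 1 ≤ i ≤ k - 1, so
  -- no subtraction truncates.
  refine ⟨fun i j l => if l = 0 ∧ i < k ∧ j < k ∧ i + j = k + α - 2 then
    a ^ (i + 1 - α) * (-b) ^ (k - 1 - i) else 0, fun i j l h => ?_, ?_, fun i j l hs hd => ?_⟩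
  · have := (ite_ne_right_iff.mp h).1
    unfold IsStandard
    omega
  · rcases hab with ha | hb
    · refine ⟨k - 1, α - 1, 0, ?_⟩
      dsimp only
      rw [if_pos (by omega)]
      simp [ha]
    · refine ⟨α - 1, k - 1, 0, ?_⟩
      dsimp only
      rw [if_pos (by omega), show α - 1 + 1 - α = 0 by omega]
      simp [hb]
  · unfold IsStandard at hs
    simp only [linearMulCoeff]
    rcases Nat.eq_zero_or_pos l with rfl | hl
    · obtain ⟨m, rfl⟩ : ∃ m, i = α + m := ⟨i - α, by omega⟩
      obtain ⟨n, rfl⟩ : ∃ n, k = α + m + 1 + n := ⟨k - (α + m + 1), by omega⟩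
      obtain rfl : j = α + n := by omega
      rw [if_neg (by omega), if_pos (by omega), if_neg (by omega), if_pos (by omega),
        show α + m - 1 + 1 - α = m by omega, show α + m + 1 - α = m + 1 by omega,
        show α + m + 1 + n - 1 - (α + m - 1) = n + 1 by omega,
        show α + m + 1 + n - 1 - (α + m) = n by omega]
      ring
    · rw [if_neg (c := l = 0 ∧ i - 1 < k ∧ j < k ∧ i - 1 + j = k + α - 2) (by omega),
        if_neg (c := l = 0 ∧ i < k ∧ j - 1 < k ∧ i + (j - 1) = k + α - 2) (by omega)]
      simp

lemma HasKernel.zero {k α : ℕ} (hα : 1 ≤ α) (hk : α < k) :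
    HasKernel k α (k + α - 2) (0 : K) 0 0 := by
  obtain ⟨g, hg, hne, -⟩ := HasKernel.of_two hα hk (1 : K) 1 (Or.inl one_ne_zero)
  exact ⟨g, hg, hne, fun i j l _ _ => by simp [linearMulCoeff]⟩

/-- The image of a linear form in two variables is not everything on the part of the quotient of
maximal degree in the third. -/
lemma HasCokernel.of_two {k α : ℕ} (hα : 1 ≤ α) (hk : α < k) (a b : K) (hab : a ≠ 0 ∨ b ≠ 0) :
    HasCokernel k α (k + α - 2) a b 0 := by
  -- The functional takes the binary form of degree α multiplying z^(k-1) and evaluates it at (-b,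
  -- a), the zero of ax + by.
  refine ⟨fun i j l => if l = k - 1 ∧ i + j = α then (-b) ^ i * a ^ j else 0,
    fun i j l h => ?_, ?_, fun i j l hd => ?_⟩
  · have := (ite_ne_right_iff.mp h).1
    unfold IsStandard
    omega
  · rcases hab with ha | hb
    · refine ⟨0, α, k - 1, ?_⟩
      dsimp only
      rw [if_pos (by omega)]
      simp [ha]
    · refine ⟨α, 0, k - 1, ?_⟩
      dsimp only
      rw [if_pos (by omega)]
      simp [hb]
  · by_cases h : l = k - 1 ∧ i + 1 + j = α
    · dsimp only
      rw [if_pos (by omega), if_pos (by omega)]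
      ring
    · dsimp only
      rw [if_neg (by omega), if_neg (by omega)]
      simp

lemma HasCokernel.zero {k α : ℕ} (hα : 1 ≤ α) (hk : α < k) :
    HasCokernel k α (k + α - 2) (0 : K) 0 0 := by
  obtain ⟨g, hg, hne, -⟩ := HasCokernel.of_two hα hk (1 : K) 1 (Or.inl one_ne_zero)
  exact ⟨g, hg, hne, fun i j l _ => by simp⟩

/-! ### Counting orbits of the transposition of x and y. -/

/-- The exponents `(i, j, l)` with `i ≤ j` of standard monomials of degree `d`: representatives of
the orbits of the transposition of the first two variables. -/
def orbitReps (k α d : ℕ) : Finset (ℕ × ℕ × ℕ) :=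
  (Finset.range k ×ˢ Finset.range k ×ˢ Finset.range k).filter fun s =>
    IsStandard k α s.1 s.2.1 s.2.2 ∧ s.1 + s.2.1 + s.2.2 = d ∧ s.1 ≤ s.2.1

/-- The exponents `(i, j, l)` with `i < j` of standard monomials of degree `d`: representatives of
the free orbits of the transposition of the first two variables. -/
def freeOrbitReps (k α d : ℕ) : Finset (ℕ × ℕ × ℕ) :=
  (Finset.range k ×ˢ Finset.range k ×ˢ Finset.range k).filter fun s =>
    IsStandard k α s.1 s.2.1 s.2.2 ∧ s.1 + s.2.1 + s.2.2 = d ∧ s.1 < s.2.1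

lemma mem_orbitReps {k α d i j l : ℕ} :
    (i, j, l) ∈ orbitReps k α d ↔ IsStandard k α i j l ∧ i + j + l = d ∧ i ≤ j := by
  simp only [orbitReps, Finset.mem_filter, Finset.mem_product, Finset.mem_range]
  unfold IsStandard
  omega

lemma mem_freeOrbitReps {k α d i j l : ℕ} :
    (i, j, l) ∈ freeOrbitReps k α d ↔ IsStandard k α i j l ∧ i + j + l = d ∧ i < j := by
  simp only [freeOrbitReps, Finset.mem_filter, Finset.mem_product, Finset.mem_range]
  unfold IsStandard
  omega

/-- If there are more orbits in degree `d` than in degree `d + 1`, multiplication by `x + y + z`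
has a kernel on symmetric forms. -/
lemma HasKernel.one_of_card_lt {k α d : ℕ}
    (h : (orbitReps k α (d + 1)).card < (orbitReps k α d).card) :
    HasKernel k α d (1 : K) 1 1 := by
  let sym (h : ℕ × ℕ × ℕ → K) (i j l : ℕ) : K := h (min i j, max i j, l)
  let E : (ℕ × ℕ × ℕ → K) →ₗ[K] (ℕ × ℕ × ℕ → K) :=
    { toFun := fun h s => linearMulCoeff 1 1 1 (sym h) s.1 s.2.1 s.2.2
      map_add' := fun f g => by
        ext s
        simp only [linearMulCoeff, sym, Pi.add_apply]
        split_ifs <;> ring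
      map_smul' := fun r f => by
        ext s
        simp only [linearMulCoeff, sym, Pi.smul_apply, smul_eq_mul, RingHom.id_apply]
        split_ifs <;> ring }
  obtain ⟨h, hne, hsupp, h0⟩ := exists_ne_zero_supported _ _ h E
  obtain ⟨⟨i, j, l⟩, hijl⟩ := Function.ne_iff.mp hne
  have hcomm : ∀ i j l, sym h i j l = sym h j i l := fun i j l => by
    simp only [sym, min_comm, max_comm]
  refine ⟨sym h, fun i j l hs => ?_, ⟨i, j, l, ?_⟩, fun i j l hs hd => ?_⟩
  · have := mem_orbitReps.mp (hsupp _ hs)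
    unfold IsStandard at *
    omega
  · have := mem_orbitReps.mp (hsupp _ hijl)
    simpa [sym, this.2.2] using hijl
  · rcases le_total i j with hij | hij
    · exact h0 (i, j, l) (mem_orbitReps.mpr ⟨hs, hd, hij⟩)
    · have := h0 (j, i, l) (mem_orbitReps.mpr ⟨by unfold IsStandard at *; omega, by omega, hij⟩)
      rw [← this]
      simp only [E, LinearMap.coe_mk, AddHom.coe_mk, linearMulCoeff]
      rw [hcomm (i - 1) j l, hcomm i (j - 1) l, hcomm i j (l - 1)]
      ring

/-- If there are more free orbits in degree `d + 1` than in degree `d`, the image of multiplication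
by `x + y + z` is annihilated by an alternating functional. -/
lemma HasCokernel.one_of_card_lt {k α d : ℕ}
    (h : (freeOrbitReps k α d).card < (freeOrbitReps k α (d + 1)).card) :
    HasCokernel k α d (1 : K) 1 1 := by
  -- The value 0 on the diagonal is imposed: in characteristic 2 it would not follow from the sign
  -- rule.
  let alt (h : ℕ × ℕ × ℕ → K) (i j l : ℕ) : K :=
    if i < j then h (i, j, l) else if j < i then -h (j, i, l) else 0
  let E : (ℕ × ℕ × ℕ → K) →ₗ[K] (ℕ × ℕ × ℕ → K) :=
    { toFun := fun h s => alt h (s.1 + 1) s.2.1 s.2.2 + alt h s.1 (s.2.1 + 1) s.2.2 +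
        alt h s.1 s.2.1 (s.2.2 + 1)
      map_add' := fun f g => by
        ext s
        simp only [alt, Pi.add_apply]
        split_ifs <;> ring
      map_smul' := fun r f => by
        ext s
        simp only [alt, Pi.smul_apply, smul_eq_mul, RingHom.id_apply]
        split_ifs <;> ring }
  obtain ⟨h, hne, hsupp, h0⟩ := exists_ne_zero_supported _ _ h E
  obtain ⟨⟨i, j, l⟩, hijl⟩ := Function.ne_iff.mp hne
  have halt : ∀ i j l, alt h i j l = -alt h j i l := fun i j l => by
    simp only [alt]
    split_ifs <;> first | omega | simp
  have hdiag : ∀ i l, alt h i i l = 0 := fun i l => by simp [alt]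
  have hstd : ∀ i j l, alt h i j l ≠ 0 → IsStandard k α i j l ∧ i + j + l = d + 1 := by
    intro i j l hs
    simp only [alt] at hs
    split_ifs at hs
    · have := mem_freeOrbitReps.mp (hsupp _ hs)
      exact ⟨this.1, this.2.1⟩
    · have := mem_freeOrbitReps.mp (hsupp _ (neg_ne_zero.mp hs))
      unfold IsStandard at *
      omega
    · exact absurd rfl hs
  have hlt : ∀ i j l, i + j + l = d → i < j →
      alt h (i + 1) j l + alt h i (j + 1) l + alt h i j (l + 1) = 0 := by
    intro i j l hd hij
    by_cases hs : IsStandard k α i j l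
    · exact h0 (i, j, l) (mem_freeOrbitReps.mpr ⟨hs, hd, hij⟩)
    -- Multiples of a monomial in the ideal stay in the ideal, so all three terms vanish.
    · have h1 : alt h (i + 1) j l = 0 := by
        by_contra hc
        have := hstd _ _ _ hc
        unfold IsStandard at *
        omega
      have h2 : alt h i (j + 1) l = 0 := by
        by_contra hc
        have := hstd _ _ _ hc
        unfold IsStandard at *
        omega
      have h3 : alt h i j (l + 1) = 0 := by
        by_contra hc
        have := hstd _ _ _ hc
        unfold IsStandard at *
        omega
      rw [h1, h2, h3]
      simp
  refine ⟨alt h, hstd, ⟨i, j, l, ?_⟩, fun i j l hd => ?_⟩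
  · have := mem_freeOrbitReps.mp (hsupp _ hijl)
    simpa [alt, this.2.2] using hijl
  · simp only [one_mul]
    rcases lt_trichotomy i j with hij | rfl | hij
    · exact hlt i j l hd hij
    · rw [hdiag, halt (i + 1) i l]
      ring
    · rw [halt (i + 1) j l, halt i (j + 1) l, halt i j (l + 1)]
      linear_combination -hlt j i l (by omega) hij

lemma card_lt_card_of_injOn_of_notMem {ι : Type*} {S T : Finset ι} (f : ι → ι)
    (hf : ∀ s ∈ S, f s ∈ T) (hinj : ∀ s ∈ S, ∀ t ∈ S, f s = f t → s = t) (x : ι) (hx : x ∈ T)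
    (hxf : ∀ s ∈ S, f s ≠ x) : S.card < T.card := by
  classical
  rw [← Finset.card_image_of_injOn (s := S) (f := f) fun s hs t ht h => hinj s hs t ht h]
  refine Finset.card_lt_card ⟨fun y hy => ?_, fun h => ?_⟩
  · obtain ⟨s, hs, rfl⟩ := Finset.mem_image.mp hy
    exact hf s hs
  · obtain ⟨s, hs, hsx⟩ := Finset.mem_image.mp (h hx)
    exact hxf s hs hsx

/-- The injection divides by x when l = 0 and by y otherwise, where i = 0. The point (m, m, 0) could
only come from (m + 1, m, 0), which violates i ≤ j. -/
lemma card_orbitReps_one_lt {m : ℕ} (hm : 1 ≤ m) :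
    (orbitReps (2 * m + 1) 1 (2 * m + 1)).card < (orbitReps (2 * m + 1) 1 (2 * m)).card := by
  refine card_lt_card_of_injOn_of_notMem
    (fun s => if s.2.2 = 0 then (s.1 - 1, s.2.1, s.2.2) else (s.1, s.2.1 - 1, s.2.2))
    ?_ ?_ (m, m, 0) ?_ ?_
  · rintro ⟨i, j, l⟩ hs
    rw [mem_orbitReps] at hs
    dsimp only
    unfold IsStandard at hs
    split_ifs <;> rw [mem_orbitReps] <;> unfold IsStandard <;> omega
  · rintro ⟨i, j, l⟩ hs ⟨i', j', l'⟩ hs' h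
    rw [mem_orbitReps] at hs hs'
    unfold IsStandard at hs hs'
    dsimp only at h
    split_ifs at h <;> simp only [Prod.mk.injEq] at h ⊢ <;> omega
  · rw [mem_orbitReps]
    unfold IsStandard
    omega
  · rintro ⟨i, j, l⟩ hs h
    rw [mem_orbitReps] at hs
    unfold IsStandard at hs
    dsimp only at h
    split_ifs at h <;> simp only [Prod.mk.injEq] at h <;> omega

/-- The injection multiplies by x when l = 0 and by y otherwise. For l = 0 the sum i + j = 2m is
even, so i < j gives i + 1 < j. The point (0, 1, 2m) could only come from (0, 0, 2m), whose orbit is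
not free. -/
lemma card_freeOrbitReps_one_lt {m : ℕ} (hm : 1 ≤ m) :
    (freeOrbitReps (2 * m + 1) 1 (2 * m)).card <
      (freeOrbitReps (2 * m + 1) 1 (2 * m + 1)).card := by
  refine card_lt_card_of_injOn_of_notMem
    (fun s => if s.2.2 = 0 then (s.1 + 1, s.2.1, s.2.2) else (s.1, s.2.1 + 1, s.2.2))
    ?_ ?_ (0, 1, 2 * m) ?_ ?_
  · rintro ⟨i, j, l⟩ hs
    rw [mem_freeOrbitReps] at hs
    dsimp only
    unfold IsStandard at hs
    split_ifs <;> rw [mem_freeOrbitReps] <;> unfold IsStandard <;> omega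
  · rintro ⟨i, j, l⟩ hs ⟨i', j', l'⟩ hs' h
    rw [mem_freeOrbitReps] at hs hs'
    unfold IsStandard at hs hs'
    dsimp only at h
    split_ifs at h <;> simp only [Prod.mk.injEq] at h ⊢ <;> omega
  · rw [mem_freeOrbitReps]
    unfold IsStandard
    omega
  · rintro ⟨i, j, l⟩ hs h
    rw [mem_freeOrbitReps] at hs
    unfold IsStandard at hs
    dsimp only at h
    split_ifs at h <;> simp only [Prod.mk.injEq] at h <;> omega

/-- Dividing by x for l ≤ 2 and by y for l ≥ 3 breaks i ≤ j only at (2, 2, 2m - 1). It leaves two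
diagonal points uncovered, (m + 1, m + 1, 0) and (m, m, 2). The first receives the exception and the
second stays free. -/
lemma card_orbitReps_three_lt {m : ℕ} (hm : 3 ≤ m) :
    (orbitReps (2 * m + 1) 3 (2 * m + 3)).card < (orbitReps (2 * m + 1) 3 (2 * m + 2)).card := by
  refine card_lt_card_of_injOn_of_notMem
    (fun s => if s.2.2 ≤ 2 then (s.1 - 1, s.2.1, s.2.2) else
      if s.1 = 2 ∧ s.2.1 = 2 then (m + 1, m + 1, 0) else (s.1, s.2.1 - 1, s.2.2))
    ?_ ?_ (m, m, 2) ?_ ?_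
  · rintro ⟨i, j, l⟩ hs
    rw [mem_orbitReps] at hs
    dsimp only
    unfold IsStandard at hs
    split_ifs <;> rw [mem_orbitReps] <;> unfold IsStandard <;> omega
  · rintro ⟨i, j, l⟩ hs ⟨i', j', l'⟩ hs' h
    rw [mem_orbitReps] at hs hs'
    unfold IsStandard at hs hs'
    dsimp only at h
    split_ifs at h <;> simp only [Prod.mk.injEq] at h ⊢ <;> omega
  · rw [mem_orbitReps]
    unfold IsStandard
    omega
  · rintro ⟨i, j, l⟩ hs h
    rw [mem_orbitReps] at hs
    unfold IsStandard at hs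
    dsimp only at h
    split_ifs at h <;> simp only [Prod.mk.injEq] at h <;> omega

/-- Multiplying by x for l ≤ 2 and by y for l ≥ 3 breaks i < j only at (m, m + 1, 1), since i + j is
even for l = 0, 2. The points (1, 2, 2m) and (2, 3, 2m - 2) are uncovered, as their preimages under
multiplication by y would have i = j; the first receives the exception. The bound 3 ≤ m gives 2m - 2
> 2: for m = 2 the first rule would send (1, 3, 2) to (2, 3, 2). -/
lemma card_freeOrbitReps_three_lt {m : ℕ} (hm : 3 ≤ m) :
    (freeOrbitReps (2 * m + 1) 3 (2 * m + 2)).card <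
      (freeOrbitReps (2 * m + 1) 3 (2 * m + 3)).card := by
  refine card_lt_card_of_injOn_of_notMem
    (fun s => if s.2.2 ≤ 2 then
      if s.1 = m ∧ s.2.2 = 1 then (1, 2, 2 * m) else (s.1 + 1, s.2.1, s.2.2)
      else (s.1, s.2.1 + 1, s.2.2))
    ?_ ?_ (2, 3, 2 * m - 2) ?_ ?_
  · rintro ⟨i, j, l⟩ hs
    rw [mem_freeOrbitReps] at hs
    dsimp only
    unfold IsStandard at hs
    split_ifs <;> rw [mem_freeOrbitReps] <;> unfold IsStandard <;> omega
  · rintro ⟨i, j, l⟩ hs ⟨i', j', l'⟩ hs' h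
    rw [mem_freeOrbitReps] at hs hs'
    unfold IsStandard at hs hs'
    dsimp only at h
    split_ifs at h <;> simp only [Prod.mk.injEq] at h ⊢ <;> omega
  · rw [mem_freeOrbitReps]
    unfold IsStandard
    omega
  · rintro ⟨i, j, l⟩ hs h
    rw [mem_freeOrbitReps] at hs
    unfold IsStandard at hs
    dsimp only at h
    split_ifs at h <;> simp only [Prod.mk.injEq] at h <;> omega

/-! ### From x + y + z to all linear forms. -/

lemma hasKernel_of_one {k α : ℕ} (hα : 1 ≤ α) (hk : α < k)
    (h : HasKernel k α (k + α - 2) (1 : K) 1 1) (a b c : K) :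
    HasKernel k α (k + α - 2) a b c := by
  by_cases ha : a = 0
  · by_cases hb : b = 0
    · by_cases hc : c = 0
      · subst ha hb hc
        exact .zero hα hk
      · subst ha
        exact (HasKernel.of_two hα hk b c (.inr hc)).swap_right.swap_left
    · subst ha
      exact (HasKernel.of_two hα hk b c (.inl hb)).swap_right.swap_left
  · by_cases hb : b = 0
    · subst hb
      exact (HasKernel.of_two hα hk a c (.inl ha)).swap_right
    · by_cases hc : c = 0
      · subst hc
        exact .of_two hα hk a b (.inl ha)
      · exact h.of_one ha hb hc

lemma hasCokernel_of_one {k α : ℕ} (hα : 1 ≤ α) (hk : α < k)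
    (h : HasCokernel k α (k + α - 2) (1 : K) 1 1) (a b c : K) :
    HasCokernel k α (k + α - 2) a b c := by
  by_cases ha : a = 0
  · by_cases hb : b = 0
    · by_cases hc : c = 0
      · subst ha hb hc
        exact .zero hα hk
      · subst ha
        exact (HasCokernel.of_two hα hk b c (.inr hc)).swap_right.swap_left
    · subst ha
      exact (HasCokernel.of_two hα hk b c (.inl hb)).swap_right.swap_left
  · by_cases hb : b = 0
    · subst hb
      exact (HasCokernel.of_two hα hk a c (.inl ha)).swap_right
    · by_cases hc : c = 0
      · subst hc
        exact .of_two hα hk a b (.inl ha)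
      · exact h.of_one ha hb hc

end Exponents

end MonomialACI

namespace MonomialACI

/-! ### Transfer to the quotient ring: failure of the WLP, and the socle. -/

section Ideal

variable (K : Type*) [Field K]

/-- The exponents of the monomials `x^k, y^k, z^k, x^α y^α z^α`. -/
noncomputable def generatorExponent (k α : ℕ) : Fin 4 → (Fin 3 →₀ ℕ) :=
  ![Finsupp.single 0 k, Finsupp.single 1 k, Finsupp.single 2 k,
    Finsupp.equivFunOnFinite.symm fun _ => α]

/-- The ideal `(x^k, y^k, z^k, x^α y^α z^α)`. -/
noncomputable def aciIdeal (k α : ℕ) : Ideal (MvPolynomial (Fin 3) K) :=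
  Ideal.span {X 0 ^ k, X 1 ^ k, X 2 ^ k, X 0 ^ α * X 1 ^ α * X 2 ^ α}

lemma range_monomial_generatorExponent (k α : ℕ) :
    (Set.range fun n => monomial (generatorExponent k α n) (1 : K)) =
      {X 0 ^ k, X 1 ^ k, X 2 ^ k, X 0 ^ α * X 1 ^ α * X 2 ^ α} := by
  have h : monomial (Finsupp.equivFunOnFinite.symm fun _ : Fin 3 => α) (1 : K) =
      X 0 ^ α * X 1 ^ α * X 2 ^ α := by
    rw [monomial_eq, Finsupp.prod_fintype _ _ (by simp), Fin.prod_univ_three]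
    simp
  rw [← h]
  ext f
  simp [Fin.exists_fin_succ, generatorExponent, X_pow_eq_monomial, eq_comm]

lemma aciIdeal_eq_span (k α : ℕ) :
    aciIdeal K k α = Ideal.span ((fun s => monomial s (1 : K)) ''
      Set.range (generatorExponent k α)) := by
  rw [aciIdeal, ← range_monomial_generatorExponent, ← Set.range_comp]
  rfl

lemma isMonomialIdeal_aciIdeal (k α : ℕ) : IsMonomialIdeal (aciIdeal K k α) :=
  ⟨_, aciIdeal_eq_span K k α⟩

lemma exists_generatorExponent_le_iff {k α : ℕ} (m : Fin 3 →₀ ℕ) :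
    (∃ n, generatorExponent k α n ≤ m) ↔ ¬ IsStandard k α (m 0) (m 1) (m 2) := by
  simp only [Fin.exists_fin_succ, generatorExponent, Finsupp.le_def, Fin.forall_fin_succ]
  simp [IsStandard]
  omega

variable {K}

lemma mem_aciIdeal {k α : ℕ} {f : MvPolynomial (Fin 3) K} :
    f ∈ aciIdeal K k α ↔ ∀ m, IsStandard k α (m 0) (m 1) (m 2) → coeff m f = 0 := by
  rw [aciIdeal_eq_span, mem_ideal_span_monomial_image]
  simp only [Set.exists_range_iff, exists_generatorExponent_le_iff, mem_support_iff]
  exact forall_congr' fun m => by tauto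

/-- The exponent vector with given entries. -/
noncomputable def exponent (i j l : ℕ) : Fin 3 →₀ ℕ := Finsupp.equivFunOnFinite.symm ![i, j, l]

@[simp] lemma exponent_zero (i j l : ℕ) : exponent i j l 0 = i := rfl

@[simp] lemma exponent_one (i j l : ℕ) : exponent i j l 1 = j := rfl

@[simp] lemma exponent_two (i j l : ℕ) : exponent i j l 2 = l := rfl

lemma degree_eq_add (m : Fin 3 →₀ ℕ) : m.degree = m 0 + m 1 + m 2 := by
  rw [Finsupp.degree_eq_sum, Fin.sum_univ_three]

lemma exists_eq_of_isHomogeneous_one {L : MvPolynomial (Fin 3) K} (hL : L.IsHomogeneous 1) :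
    ∃ a b c : K, L = C a * X 0 + C b * X 1 + C c * X 2 := by
  have h : L ∈ homogeneousSubmodule (Fin 3) K 1 := hL
  rw [homogeneousSubmodule_one_eq_span_X, Submodule.mem_span_range_iff_exists_fun] at h
  obtain ⟨c, rfl⟩ := h
  exact ⟨c 0, c 1, c 2, by simp [Fin.sum_univ_three, smul_eq_C_mul]⟩

lemma coeff_linear_mul (a b c : K) (f : MvPolynomial (Fin 3) K) (g : ℕ → ℕ → ℕ → K)
    (hf : ∀ m, coeff m f = g (m 0) (m 1) (m 2)) (m : Fin 3 →₀ ℕ) :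
    coeff m ((C a * X 0 + C b * X 1 + C c * X 2) * f) =
      linearMulCoeff a b c g (m 0) (m 1) (m 2) := by
  simp only [add_mul, mul_assoc, coeff_add, coeff_C_mul, coeff_X_mul', hf, linearMulCoeff,
    Finsupp.mem_support_iff]
  congr 1
  · congr 1
    · by_cases h : m 0 = 0 <;> simp [h]
    · by_cases h : m 1 = 0 <;> simp [h]
  · by_cases h : m 2 = 0 <;> simp [h]

lemma mk_mem_gradedPiece {I : Ideal (MvPolynomial (Fin 3) K)} {d : ℕ}
    {f : MvPolynomial (Fin 3) K} (hf : f.IsHomogeneous d) :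
    Ideal.Quotient.mk I f ∈ gradedPiece I d :=
  ⟨f, hf, rfl⟩

lemma HasKernel.not_injOn {k α d : ℕ} {a b c : K} (h : HasKernel k α d a b c) :
    ¬ Set.InjOn (fun x => Ideal.Quotient.mk (aciIdeal K k α)
        (C a * X 0 + C b * X 1 + C c * X 2) * x)
      (gradedPiece (aciIdeal K k α) d : Set (MvPolynomial (Fin 3) K ⧸ aciIdeal K k α)) := by
  obtain ⟨g, hg, ⟨i, j, l, hne⟩, h0⟩ := h
  have hfin : (Function.support fun m : Fin 3 →₀ ℕ => g (m 0) (m 1) (m 2)).Finite := by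
    refine (Set.finite_Iic (exponent d d d)).subset fun m hm => ?_
    have := (hg _ _ _ hm).2
    rw [Set.mem_Iic, Finsupp.le_def, Fin.forall_fin_succ, Fin.forall_fin_two]
    change m 0 ≤ d ∧ m 1 ≤ d ∧ m 2 ≤ d
    omega
  let f : MvPolynomial (Fin 3) K := ∑ m ∈ hfin.toFinset, monomial m (g (m 0) (m 1) (m 2))
  have hf : ∀ m, coeff m f = g (m 0) (m 1) (m 2) := fun m => by
    classical
    simp only [f, coeff_sum, coeff_monomial, Finset.sum_ite_eq']
    simp only [Set.Finite.mem_toFinset, Function.mem_support, ne_eq, ite_eq_left_iff, not_not]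
    exact fun h => h.symm
  have hhom : f.IsHomogeneous d := fun m hm => by
    rw [hf] at hm
    refine (DFunLike.congr_fun Finsupp.degree_eq_weight_one m).symm.trans ?_
    rw [degree_eq_add]
    exact (hg _ _ _ hm).2
  intro hinj
  have hmul : (C a * X 0 + C b * X 1 + C c * X 2) * f ∈ aciIdeal K k α := by
    refine mem_aciIdeal.mpr fun m hm => ?_
    rw [coeff_linear_mul a b c f g hf]
    by_cases hd : m 0 + m 1 + m 2 = d + 1
    · exact h0 _ _ _ hm hd
    · have h : ∀ i j l, i + j + l ≠ d → g i j l = 0 := fun i j l h => by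
        by_contra hc
        exact h (hg i j l hc).2
      unfold linearMulCoeff
      have h1 : (if m 0 = 0 then 0 else g (m 0 - 1) (m 1) (m 2)) = 0 := by
        split_ifs
        · rfl
        · exact h _ _ _ (by omega)
      have h2 : (if m 1 = 0 then 0 else g (m 0) (m 1 - 1) (m 2)) = 0 := by
        split_ifs
        · rfl
        · exact h _ _ _ (by omega)
      have h3 : (if m 2 = 0 then 0 else g (m 0) (m 1) (m 2 - 1)) = 0 := by
        split_ifs
        · rfl
        · exact h _ _ _ (by omega)
      rw [h1, h2, h3]
      simp
  have := hinj (mk_mem_gradedPiece hhom) (zero_mem _) (by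
    dsimp only
    rw [← map_mul, Ideal.Quotient.eq_zero_iff_mem.mpr hmul, mul_zero])
  rw [Ideal.Quotient.eq_zero_iff_mem, mem_aciIdeal] at this
  have h1 := this (exponent i j l) (hg _ _ _ hne).1
  rw [hf] at h1
  exact hne h1

/-- The functional `φ` vanishes on the ideal and on all multiples of the linear form, but not on
some monomial of degree d + 1. -/
lemma HasCokernel.not_surjOn {k α d : ℕ} {a b c : K} (h : HasCokernel k α d a b c) :
    ¬ Set.SurjOn (fun x => Ideal.Quotient.mk (aciIdeal K k α)
        (C a * X 0 + C b * X 1 + C c * X 2) * x)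
      (gradedPiece (aciIdeal K k α) d : Set (MvPolynomial (Fin 3) K ⧸ aciIdeal K k α))
      (gradedPiece (aciIdeal K k α) (d + 1) :
        Set (MvPolynomial (Fin 3) K ⧸ aciIdeal K k α)) := by
  obtain ⟨g, hg, ⟨i, j, l, hne⟩, h0⟩ := h
  let φ : MvPolynomial (Fin 3) K →ₗ[K] K :=
    (basisMonomials (Fin 3) K).constr K fun m => g (m 0) (m 1) (m 2)
  have hφ : ∀ m r, φ (monomial m r) = r * g (m 0) (m 1) (m 2) := fun m r => by
    have : φ (monomial m 1) = g (m 0) (m 1) (m 2) := by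
      have := (basisMonomials (Fin 3) K).constr_basis K (fun m => g (m 0) (m 1) (m 2)) m
      simpa only [coe_basisMonomials] using this
    rw [← this, ← smul_eq_mul, ← map_smul, smul_monomial, smul_eq_mul, mul_one]
  have hφI : ∀ f ∈ aciIdeal K k α, φ f = 0 := fun f hf => by
    rw [f.as_sum, map_sum]
    refine Finset.sum_eq_zero fun m _ => ?_
    rw [hφ]
    by_cases hm : g (m 0) (m 1) (m 2) = 0
    · rw [hm, mul_zero]
    · rw [mem_aciIdeal.mp hf m (hg _ _ _ hm).1, zero_mul]
  have hφL : ∀ f, φ ((C a * X 0 + C b * X 1 + C c * X 2) * f) = 0 := fun f => by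
    induction f using MvPolynomial.induction_on' with
    | add p q hp hq => rw [mul_add, map_add, hp, hq, add_zero]
    | monomial m r =>
      have hX : ∀ (s : K) (n : Fin 3), C s * X n * monomial m r =
          monomial (Finsupp.single n 1 + m) (s * r) := fun s n => by
        rw [C_mul_X_eq_monomial, monomial_mul]
      rw [add_mul, add_mul, hX, hX, hX, map_add, map_add, hφ, hφ, hφ]
      simp only [Finsupp.add_apply, Finsupp.single_apply]
      simp only [if_true, show ((0 : Fin 3) = 1) = False by simp,
        show ((1 : Fin 3) = 0) = False by simp,
        show ((0 : Fin 3) = 2) = False by simp, show ((2 : Fin 3) = 0) = False by simp,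
        show ((1 : Fin 3) = 2) = False by simp, show ((2 : Fin 3) = 1) = False by simp,
        if_false, zero_add]
      rw [add_comm 1, add_comm 1, add_comm 1]
      by_cases hd : m 0 + m 1 + m 2 = d
      · linear_combination r * h0 _ _ _ hd
      · have h : ∀ i j l, i + j + l ≠ d + 1 → g i j l = 0 := fun i j l h => by
          by_contra hc
          exact h (hg i j l hc).2
        rw [h _ _ _ (by omega), h _ _ _ (by omega), h _ _ _ (by omega)]
        simp
  intro hsurj
  obtain ⟨_, ⟨f, -, rfl⟩, hf⟩ := hsurj (mk_mem_gradedPiece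
    (isHomogeneous_monomial (d := exponent i j l) (1 : K)
      ((degree_eq_add _).trans (hg _ _ _ hne).2)))
  change Ideal.Quotient.mk _ _ * Ideal.Quotient.mk _ f = _ at hf
  rw [← map_mul, Ideal.Quotient.eq] at hf
  have h1 := hφI _ hf
  rw [map_sub, hφL, hφ, zero_sub, one_mul, neg_eq_zero] at h1
  exact hne h1

lemma not_hasWLP_aciIdeal {k α d : ℕ} (hker : ∀ a b c : K, HasKernel k α d a b c)
    (hcoker : ∀ a b c : K, HasCokernel k α d a b c) : ¬ HasWLP (aciIdeal K k α) := by
  rintro ⟨_, ⟨L, hL, rfl⟩, h⟩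
  obtain ⟨a, b, c, rfl⟩ := exists_eq_of_isHomogeneous_one hL
  rcases h d with h | h
  · exact (hker a b c).not_injOn h
  · exact (hcoker a b c).not_surjOn h

/-- Let m be a standard exponent occurring in a socle element, so that raising any entry leaves the
standard range. Two entries below α are impossible, since raising one keeps the other below α. So
exactly one entry is below α; it equals α - 1, and the other two equal k - 1. -/
lemma isLevel_aciIdeal {k α : ℕ} (hα : 1 ≤ α) (hk : α < k) : IsLevel (aciIdeal K k α) := by
  refine ⟨2 * k + α - 3, fun x hx => ?_⟩
  obtain ⟨f, rfl⟩ := Ideal.Quotient.mk_surjective x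
  have hX : ∀ n : Fin 3, X n * f ∈ aciIdeal K k α := fun n => by
    have := hx n
    rwa [← map_mul, Ideal.Quotient.eq_zero_iff_mem] at this
  refine ⟨homogeneousComponent (2 * k + α - 3) f, homogeneousComponent_isHomogeneous _ _, ?_⟩
  change Ideal.Quotient.mk _ _ = _
  rw [Ideal.Quotient.eq, mem_aciIdeal]
  intro m hm
  rw [coeff_sub, coeff_homogeneousComponent]
  split_ifs with hd
  · exact sub_self _
  · rw [zero_sub, neg_eq_zero]
    have h0 : ∀ n : Fin 3, IsStandard k α (m 0 + if n = 0 then 1 else 0)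
        (m 1 + if n = 1 then 1 else 0) (m 2 + if n = 2 then 1 else 0) → coeff m f = 0 := by
      intro n hn
      have := mem_aciIdeal.mp (hX n) (Finsupp.single n 1 + m) (by
        simpa [Finsupp.single_apply, add_comm] using hn)
      rwa [coeff_X_mul] at this
    have h1 := h0 0
    have h2 := h0 1
    have h3 := h0 2
    simp only [if_true, show ((0 : Fin 3) = 1) = False by simp,
      show ((1 : Fin 3) = 0) = False by simp,
      show ((0 : Fin 3) = 2) = False by simp, show ((2 : Fin 3) = 0) = False by simp,
      show ((1 : Fin 3) = 2) = False by simp, show ((2 : Fin 3) = 1) = False by simp,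
      if_false, add_zero] at h1 h2 h3
    by_contra hc
    rw [imp_iff_not (by simpa using hc)] at h1 h2 h3
    rw [degree_eq_add] at hd
    unfold IsStandard at *
    omega

lemma hasSocleDegree_aciIdeal {k α : ℕ} (hα : 1 ≤ α) (hk : α < k) :
    HasSocleDegree (aciIdeal K k α) (2 * k + α - 3) := by
  constructor
  · intro h
    have h1 : Ideal.Quotient.mk (aciIdeal K k α) (monomial (exponent (k - 1) (k - 1) (α - 1)) 1) ∈
        gradedPiece (aciIdeal K k α) (2 * k + α - 3) :=
      mk_mem_gradedPiece (isHomogeneous_monomial _ (by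
        rw [degree_eq_add]
        simp only [exponent_zero, exponent_one, exponent_two]
        omega))
    rw [h, Submodule.mem_bot, Ideal.Quotient.eq_zero_iff_mem, mem_aciIdeal] at h1
    have := h1 (exponent (k - 1) (k - 1) (α - 1)) (by
      simp only [exponent_zero, exponent_one, exponent_two]
      unfold IsStandard
      omega)
    simp at this
  · intro d hd
    rw [eq_bot_iff]
    rintro _ ⟨f, hf, rfl⟩
    change Ideal.Quotient.mk _ f = 0
    rw [Ideal.Quotient.eq_zero_iff_mem, mem_aciIdeal]
    intro m hm
    refine IsHomogeneous.coeff_eq_zero hf ?_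
    rw [degree_eq_add]
    unfold IsStandard at hm
    omega

end Ideal

end MonomialACI

namespace MonomialACI

/-! ### Artinian quotient, height 3, four minimal generators. -/

section Ideal

variable (K : Type*) [Field K]

lemma X_mem_of_isPrime {k α : ℕ} {p : Ideal (MvPolynomial (Fin 3) K)} [p.IsPrime]
    (h : aciIdeal K k α ≤ p) (n : Fin 3) : X n ∈ p := by
  refine Ideal.IsPrime.mem_of_pow_mem ‹_› k (h (Ideal.subset_span ?_))
  fin_cases n <;> simp

lemma isArtinianRing_aciIdeal (k α : ℕ) :
    IsArtinianRing (MvPolynomial (Fin 3) K ⧸ aciIdeal K k α) := by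
  have hint : Algebra.IsIntegral K (MvPolynomial (Fin 3) K ⧸ aciIdeal K k α) := by
    refine ⟨fun x => ?_⟩
    obtain ⟨f, rfl⟩ := Ideal.Quotient.mk_surjective x
    induction f using MvPolynomial.induction_on with
    | C a => exact isIntegral_algebraMap (R := K) (x := a)
    | add p q hp hq =>
      rw [map_add]
      exact hp.add hq
    | mul_X p n hp =>
      rw [map_mul]
      refine hp.mul ?_
      -- For k = 0 the ideal is the whole ring; otherwise each variable is nilpotent in the
      -- quotient, hence integral.
      by_cases hk : k = 0
      · have : (1 : MvPolynomial (Fin 3) K) ∈ aciIdeal K k α :=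
          Ideal.subset_span (by simp [hk])
        have h1 := (Ideal.eq_top_iff_one _).mpr this
        rw [Ideal.Quotient.eq_zero_iff_mem.mpr (h1 ▸ Submodule.mem_top)]
        exact isIntegral_zero
      · refine IsIntegral.of_pow (Nat.pos_of_ne_zero hk) ?_
        have : X n ^ k ∈ aciIdeal K k α := Ideal.subset_span (by fin_cases n <;> simp)
        rw [← map_pow, Ideal.Quotient.eq_zero_iff_mem.mpr this]
        exact isIntegral_zero
  have : Module.Finite K (MvPolynomial (Fin 3) K ⧸ aciIdeal K k α) := Algebra.IsIntegral.finite
  exact IsArtinianRing.of_finite K _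

/-- The substitution of zero for the variables in `s`. -/
noncomputable def killVars (s : Finset (Fin 3)) :
    MvPolynomial (Fin 3) K →ₐ[K] MvPolynomial (Fin 3) K :=
  aeval fun n => if n ∈ s then 0 else X n

variable {K}

lemma ker_killVars_le {s : Finset (Fin 3)} {p : Ideal (MvPolynomial (Fin 3) K)}
    (h : ∀ n ∈ s, X n ∈ p) : RingHom.ker (killVars K s) ≤ p := by
  intro f hf
  have hcomp : (Ideal.Quotient.mkₐ K p).comp (killVars K s) = Ideal.Quotient.mkₐ K p := by
    ext n
    by_cases hn : n ∈ s
    · simp [killVars, hn, Ideal.Quotient.eq_zero_iff_mem.mpr (h n hn)]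
    · simp [killVars, hn]
  have h1 := AlgHom.congr_fun hcomp f
  rw [AlgHom.comp_apply, RingHom.mem_ker.mp hf, map_zero] at h1
  exact Ideal.Quotient.eq_zero_iff_mem.mp h1.symm

lemma X_mem_ker_killVars {s : Finset (Fin 3)} {n : Fin 3} :
    (X n : MvPolynomial (Fin 3) K) ∈ RingHom.ker (killVars K s) ↔ n ∈ s := by
  rw [RingHom.mem_ker, killVars, aeval_X]
  simp

instance isPrime_ker_killVars (s : Finset (Fin 3)) : (RingHom.ker (killVars K s)).IsPrime :=
  RingHom.ker_isPrime _

lemma ker_killVars_lt {s : Finset (Fin 3)} {p : Ideal (MvPolynomial (Fin 3) K)}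
    (h : ∀ n ∈ s, X n ∈ p) {m : Fin 3} (hm : m ∉ s) (hmp : X m ∈ p) :
    RingHom.ker (killVars K s) < p :=
  ⟨ker_killVars_le h, fun hle => hm (X_mem_ker_killVars.mp (hle hmp))⟩

/-- The chain 0 < (x) < (x, y) < p, with the first three primes realized as kernels of
substitutions. -/
lemma three_le_height_of_isPrime {p : Ideal (MvPolynomial (Fin 3) K)} [p.IsPrime]
    (h : ∀ n, X n ∈ p) : 3 ≤ p.height := by
  have h1 := Ideal.height_add_one_le_of_lt_of_isPrime
    (ker_killVars_lt (K := K) (s := ∅) (p := RingHom.ker (killVars K {0})) (m := 0)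
      (by simp) (by simp) (X_mem_ker_killVars.mpr (by simp)))
  have h2 := Ideal.height_add_one_le_of_lt_of_isPrime
    (ker_killVars_lt (K := K) (s := {0}) (p := RingHom.ker (killVars K {0, 1})) (m := 1)
      (fun n hn => X_mem_ker_killVars.mpr (by simp_all)) (by simp)
      (X_mem_ker_killVars.mpr (by simp)))
  have h3 := Ideal.height_add_one_le_of_lt_of_isPrime
    (ker_killVars_lt (K := K) (s := {0, 1}) (p := p) (m := 2) (fun n _ => h n) (by simp) (h 2))
  calc (3 : ℕ∞) = 0 + 1 + 1 + 1 := by norm_num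
    _ ≤ (RingHom.ker (killVars K ∅)).height + 1 + 1 + 1 := by gcongr; exact zero_le
    _ ≤ (RingHom.ker (killVars K {0})).height + 1 + 1 := by gcongr
    _ ≤ (RingHom.ker (killVars K {0, 1})).height + 1 := by gcongr
    _ ≤ p.height := h3

lemma height_aciIdeal {k α : ℕ} (hα : 1 ≤ α) (hk : α < k) : (aciIdeal K k α).height = 3 := by
  apply le_antisymm
  · let m : Ideal (MvPolynomial (Fin 3) K) := Ideal.span (Set.range X)
    have hX : ∀ n, X n ∈ m := fun n => Ideal.subset_span ⟨n, rfl⟩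
    have hm : m ≠ ⊤ := by
      intro h
      have hle : m ≤ RingHom.ker (killVars K Finset.univ) := by
        refine Ideal.span_le.mpr ?_
        rintro _ ⟨n, rfl⟩
        exact X_mem_ker_killVars.mpr (Finset.mem_univ n)
      rw [h, top_le_iff] at hle
      exact RingHom.ker_ne_top _ hle
    have hle : aciIdeal K k α ≤ m := by
      refine Ideal.span_le.mpr ?_
      rintro f (rfl | rfl | rfl | rfl)
      · exact Ideal.pow_mem_of_mem _ (hX 0) _ (by omega)
      · exact Ideal.pow_mem_of_mem _ (hX 1) _ (by omega)
      · exact Ideal.pow_mem_of_mem _ (hX 2) _ (by omega)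
      · exact Ideal.mul_mem_left _ _ (Ideal.pow_mem_of_mem _ (hX 2) _ (by omega))
    refine (Ideal.height_mono hle).trans ((Ideal.height_le_spanFinrank m hm).trans ?_)
    have h1 := Submodule.spanFinrank_span_le_ncard_of_finite (R := MvPolynomial (Fin 3) K)
      (Set.finite_range (X : Fin 3 → MvPolynomial (Fin 3) K))
    have h2 : (Set.range (X : Fin 3 → MvPolynomial (Fin 3) K)).ncard ≤ 3 := by
      rw [← Set.image_univ]
      exact (Set.ncard_image_le Set.finite_univ).trans (by simp)
    exact_mod_cast h1.trans h2
  · rw [Ideal.height_eq_inf_minimalPrimes]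
    refine le_iInf₂ fun p hp => ?_
    have := hp.1.1
    exact three_le_height_of_isPrime (X_mem_of_isPrime K hp.1.2)

/-- The coefficients at the exponents of the generators. -/
noncomputable def generatorCoeffs (K : Type*) [Field K] (k α : ℕ) :
    MvPolynomial (Fin 3) K →ₗ[K] (Fin 4 → K) :=
  LinearMap.pi fun n => lcoeff K (generatorExponent k α n)

lemma generatorExponent_antichain {k α : ℕ} (hα : 1 ≤ α) (hk : α < k) {n n' : Fin 4}
    (h : generatorExponent k α n ≤ generatorExponent k α n') : n = n' := by
  fin_cases n <;> fin_cases n' <;>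
    simp [generatorExponent, Finsupp.le_def, Fin.forall_fin_succ, Finsupp.single_apply] at h ⊢ <;>
    omega

/-- An exponent of f lies above some generator. If it also lies below a generator, the antichain
property makes all three equal, so only the constant term of p contributes. Thus the four
coefficients factor through I/𝔪I, where 𝔪 = (x, y, z). -/
lemma generatorCoeffs_mul {k α : ℕ} (hα : 1 ≤ α) (hk : α < k) (p f : MvPolynomial (Fin 3) K)
    (hf : f ∈ aciIdeal K k α) :
    generatorCoeffs K k α (p * f) = constantCoeff p • generatorCoeffs K k α f := by
  ext n
  change coeff _ (p * f) = constantCoeff p * coeff _ f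
  rw [coeff_mul, Finset.sum_eq_single (0, generatorExponent k α n)]
  · rfl
  · rintro ⟨u, v⟩ huv hne
    rw [Finset.HasAntidiagonal.mem_antidiagonal] at huv
    dsimp only at huv ⊢
    by_cases hv : coeff v f = 0
    · rw [hv, mul_zero]
    · have h1 : ¬ IsStandard k α (v 0) (v 1) (v 2) := fun h => hv (mem_aciIdeal.mp hf v h)
      obtain ⟨n', hn'⟩ := (exists_generatorExponent_le_iff v).mpr h1
      have hvn : v ≤ generatorExponent k α n := huv ▸ le_add_self
      obtain rfl := generatorExponent_antichain hα hk (hn'.trans hvn)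
      have hv' : v = generatorExponent k α n' := le_antisymm hvn hn'
      rw [hv', add_eq_right] at huv
      exact absurd (Prod.ext huv hv') hne
  · intro h
    simp at h

lemma spanFinrank_aciIdeal {k α : ℕ} (hα : 1 ≤ α) (hk : α < k) :
    Submodule.spanFinrank (aciIdeal K k α) = 4 := by
  have hspan := aciIdeal_eq_span K k α
  rw [← Set.range_comp] at hspan
  apply le_antisymm
  · rw [hspan]
    refine (Submodule.spanFinrank_span_le_ncard_of_finite (Set.finite_range _)).trans ?_
    rw [← Set.image_univ]
    exact (Set.ncard_image_le Set.finite_univ).trans (by simp)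
  · have hfg : (aciIdeal K k α).FG := IsNoetherian.noetherian _
    obtain ⟨s, hcard, hs⟩ := Submodule.FG.exists_span_finset_card_eq_spanFinrank hfg
    rw [← hcard]
    -- Any ideal generators map to a spanning set of K^4, so at least four are needed.
    have hmem : ∀ f ∈ aciIdeal K k α, generatorCoeffs K k α f ∈
        Submodule.span K (generatorCoeffs K k α '' s) := by
      intro f hf
      rw [← hs] at hf
      induction hf using Submodule.span_induction with
      | mem x hx => exact Submodule.subset_span ⟨x, hx, rfl⟩
      | zero => simp
      | add x y _ _ hx hy =>
        rw [map_add]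
        exact add_mem hx hy
      | smul p x hx ih =>
        rw [smul_eq_mul, generatorCoeffs_mul hα hk p x (hs ▸ hx)]
        exact Submodule.smul_mem _ _ ih
    have htop : Submodule.span K (generatorCoeffs K k α '' s) = ⊤ := by
      rw [eq_top_iff, ← (Pi.basisFun K (Fin 4)).span_eq, Submodule.span_le]
      rintro _ ⟨n, rfl⟩
      have : (Pi.basisFun K (Fin 4)) n =
          generatorCoeffs K k α (monomial (generatorExponent k α n) 1) := by
        ext n'
        change Pi.basisFun K (Fin 4) n n' =
          coeff (generatorExponent k α n') (monomial (generatorExponent k α n) (1 : K))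
        classical
        rw [coeff_monomial, Pi.basisFun_apply, Pi.single_apply]
        exact if_congr ⟨fun h => h ▸ rfl, fun h => (generatorExponent_antichain hα hk h.le).symm⟩
          rfl rfl
      rw [this]
      refine hmem _ ?_
      rw [hspan]
      exact Ideal.subset_span ⟨n, rfl⟩
    classical
    have := finrank_span_finset_le_card (R := K) (s.image (generatorCoeffs K k α))
    rw [Set.finrank, Finset.coe_image, htop, finrank_top, Module.finrank_fin_fun] at this
    exact this.trans Finset.card_image_le

lemma isAlmostCompleteIntersection_aciIdeal {k α : ℕ} (hα : 1 ≤ α) (hk : α < k) :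
    IsAlmostCompleteIntersection (aciIdeal K k α) := by
  refine ⟨IsNoetherian.noetherian _, ?_⟩
  rw [spanFinrank_aciIdeal hα hk, height_aciIdeal hα hk]
  norm_num

end Ideal

end MonomialACI

theorem corollary6p6 {K : Type*} [Field K] (e : ℕ) (he : Even e)
    (h_small : e ∉ ({0, 2, 6, 10} : Finset ℕ)) :
    ∃ I : Ideal (MvPolynomial (Fin 3) K),
      (∃ α k : ℕ, (α = 1 ∨ α = 3) ∧ Odd k ∧ 2 * α + 1 ≤ k ∧
        I = Ideal.span {X 0 ^ k, X 1 ^ k, X 2 ^ k, X 0 ^ α * X 1 ^ α * X 2 ^ α}) ∧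
      MonomialACI.IsMonomialIdeal I ∧
      IsArtinianRing (MvPolynomial (Fin 3) K ⧸ I) ∧
      MonomialACI.IsAlmostCompleteIntersection I ∧
      MonomialACI.IsLevel I ∧
      MonomialACI.HasSocleDegree I e ∧
      ¬ MonomialACI.HasWLP I := by
  open MonomialACI in
  obtain ⟨α, m, hα, hm, hed, hker, hcoker⟩ : ∃ α m : ℕ, (α = 1 ∨ α = 3) ∧ α ≤ m ∧
      e = 2 * (2 * m + 1) + α - 3 ∧
      HasKernel (2 * m + 1) α (2 * m + 1 + α - 2) (1 : K) 1 1 ∧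
      HasCokernel (2 * m + 1) α (2 * m + 1 + α - 2) (1 : K) 1 1 := by
    obtain ⟨n, rfl⟩ := he
    simp only [Finset.mem_insert, Finset.mem_singleton, not_or] at h_small
    -- The residue of e modulo 4 selects α: e = 4m gives α = 1, and e = 4m + 2 gives α = 3.
    -- Excluding 0 yields 1 ≤ m, and excluding 2, 6, 10 yields 3 ≤ m.
    rcases Nat.even_or_odd' n with ⟨m, rfl | rfl⟩
    · have hm : 1 ≤ m := by omega
      exact ⟨1, m, .inl rfl, hm, by omega, .one_of_card_lt (card_orbitReps_one_lt hm),
        .one_of_card_lt (card_freeOrbitReps_one_lt hm)⟩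
    · have hm : 3 ≤ m := by omega
      exact ⟨3, m, .inr rfl, hm, by omega, .one_of_card_lt (card_orbitReps_three_lt hm),
        .one_of_card_lt (card_freeOrbitReps_three_lt hm)⟩
  have hα1 : 1 ≤ α := by omega
  have hk : α < 2 * m + 1 := by omega
  subst hed
  exact ⟨aciIdeal K (2 * m + 1) α, ⟨α, 2 * m + 1, hα, ⟨m, rfl⟩, by omega, rfl⟩,
    isMonomialIdeal_aciIdeal K _ _, isArtinianRing_aciIdeal K _ _,
    isAlmostCompleteIntersection_aciIdeal hα1 hk, isLevel_aciIdeal hα1 hk,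
    hasSocleDegree_aciIdeal hα1 hk,
    not_hasWLP_aciIdeal (hasKernel_of_one hα1 hk hker) (hasCokernel_of_one hα1 hk hcoker)⟩
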